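/- Let $\mathbb{I}^3=\mathbb{R}^3$ with coordinates $(t,x,y)$ and the degenerate inner product $dx^2+dy^2$. A map $f\colon\mathbb{C}\to\mathbb{I}^3$ is a ZMC-face if $f=\operatorname{Re}F$ for some holomorphic immersion $F=(F^0,F^1,F^2)\colon\mathbb{C}\to\mathbb{C}^3$ (a holomorphic lift of $f$) with $(dF^1)^2+(dF^2)^2=0$ and $F^1$ non-constant. It is of finite type if its lift-metric $ds^2_\#=|dF^0|^2+|dF^1|^2+|dF^2|^2$ is a Riemannian metric with finite absolute total Gaussian curvature, i.e. $\int_{\mathbb{C}}|K_\#|\,dA_\#<\infty$. Let $\varphi\colon\mathbb{R}^2\to\mathbb{R}$ be a harmonic function, identify $\mathbb{R}^2$ with $\mathbb{C}$ by $z=x+iy$, put $\varphi_z=\tfrac12(\varphi_x-i\varphi_y)$, and let $f\colon\mathbb{C}\to\mathbb{I}^3$, $f(x+iy)=(\varphi(x,y),x,y)$, be the graph of $\varphi$. Then $f$ is a ZMC-face, and $f$ is of finite type if and only if $\varphi$ is a harmonic polynomial. Moreover, the lift-metric of $f$ (for every holomorphic lift) is $(2+|2\varphi_z|^2)\,|dz|^2$;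 $f$ is of finite type if and only if this metric has finite absolute total curvature, and this holds if and only if $\varphi_z$ is a polynomial in $z$ with complex coefficients. -/

import Mathlib

open MeasureTheory

noncomputable section

namespace IsotropicSpace

/-- The underlying vector space of the isotropic `3`-space, with coordinates `(t, x, y)` indexed by
`0, 1, 2`; its degenerate inner product is `dx² + dy²`. -/
abbrev I3 : Type := Fin 3 → ℝ

/-- A `(0++)`-type null holomorphic immersion `F = (F⁰, F¹, F²) : ℂ → ℂ³`. -/
structure IsNullImmersion (F : ℂ → Fin 3 → ℂ) : Prop where
  holomorphic : Differentiable ℂ F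
  immersion : ∀ z, deriv F z ≠ 0
  null : ∀ z, deriv (fun w => F w 1) z ^ 2 + deriv (fun w => F w 2) z ^ 2 = 0
  nonconstant : ¬ ∃ c : ℂ, ∀ z, F z 1 = c

/-- `F` is a holomorphic lift of `f : ℂ → 𝕀³`. The universal cover of `ℂ` is `ℂ` itself. -/
structure IsHolomorphicLift (F : ℂ → Fin 3 → ℂ) (f : ℂ → I3) : Prop where
  isNullImmersion : IsNullImmersion F
  re_eq : ∀ z i, f z i = (F z i).re

/-- ZMC-faces defined on the Riemann surface `ℂ`. -/
def IsZMCFace (f : ℂ → I3) : Prop :=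
  ∃ F : ℂ → Fin 3 → ℂ, IsHolomorphicLift F f

/-- The density `ρ` of the lift-metric `|dF⁰|² + |dF¹|² + |dF²|² = ρ |dz|²`. -/
def liftDensity (F : ℂ → Fin 3 → ℂ) (z : ℂ) : ℝ :=
  ∑ i, ‖deriv (fun w => F w i) z‖ ^ 2

/-- `ρ |dz|²` is a (smooth, conformal) Riemannian metric on `ℂ`. -/
def IsConformalMetric (ρ : ℂ → ℝ) : Prop :=
  ContDiff ℝ (⊤ : ℕ∞) ρ ∧ ∀ z, 0 < ρ z

/-- The Gaussian curvature `K = - Δ(log ρ) / (2ρ)` of the metric `ρ |dz|²`. -/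
def gaussCurvature (ρ : ℂ → ℝ) (z : ℂ) : ℝ :=
  -(Laplacian.laplacian (fun w => Real.log (ρ w)) z) / (2 * ρ z)

/-- The area measure `dA = ρ dx dy` of the metric `ρ |dz|²`. -/
def areaMeasure (ρ : ℂ → ℝ) : Measure ℂ :=
  volume.withDensity fun z => ENNReal.ofReal (ρ z)

/-- The metric `ρ |dz|²` has finite absolute total curvature: `∫ |K| dA < ∞`. -/
def HasFiniteTotalCurvature (ρ : ℂ → ℝ) : Prop :=
  ∫⁻ z, ‖gaussCurvature ρ z‖ₑ ∂(areaMeasure ρ) < ⊤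

/-- `f` is a finite-type ZMC-face: its lift-metric is a Riemannian metric with finite absolute
total curvature. (Two lifts of `f` differ by a constant, so they have the same lift-metric.) -/
def IsFiniteTypeZMCFace (f : ℂ → I3) : Prop :=
  ∃ F : ℂ → Fin 3 → ℂ, IsHolomorphicLift F f ∧
    IsConformalMetric (liftDensity F) ∧ HasFiniteTotalCurvature (liftDensity F)

/-- The graph `x + iy ↦ (φ(x, y), x, y)`, where `ℝ²` is identified with `ℂ`. -/
def graph (φ : ℂ → ℝ) (z : ℂ) : I3 := ![φ z, z.re, z.im]

/-- The Wirtinger derivative `φ_z = (φ_x - i φ_y) / 2`. -/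
def wirtinger (φ : ℂ → ℝ) (z : ℂ) : ℂ :=
  ((fderiv ℝ φ z 1 : ℂ) - Complex.I * (fderiv ℝ φ z Complex.I : ℂ)) / 2

/-- `φ` is a harmonic function that is a real polynomial in `x` and `y`. -/
def IsHarmonicPolynomial (φ : ℂ → ℝ) : Prop :=
  InnerProductSpace.HarmonicOnNhd φ Set.univ ∧
    ∃ P : MvPolynomial (Fin 2) ℝ, ∀ z : ℂ, φ z = MvPolynomial.eval ![z.re, z.im] P

end IsotropicSpace

end

/-!
Write `φ = Re G` with `G` entire. Any lift of the graph has `|dF|² = ρ |dz|²` with `ρ = 2 + |G'|²`,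
and `|K| dA = ½ |Δ log ρ| dx dy`, where `u = log ρ` is nonnegative and subharmonic because it is the
composition of the subharmonic function `log (2 + |w|²)` with the holomorphic map `G'`. By Green's
formula the circle means of `u` have `r d/dr`-derivative `(2π)⁻¹ ∫_{|z| < r} Δu`. Hence `Δu` is
integrable exactly when the circle means grow at most logarithmically; by the sub-mean value
property this says `u = O(log |z|)`, i.e. `G'` has polynomial growth, i.e. `G'` and hence `G` is a
polynomial. Conversely, if `φ` is a polynomial in `x` and `y`, then it has polynomial growth, and by
the Borel–Carathéodory inequality so has `G`.
-/

section Laplacian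

open Laplacian

variable {E F : Type*} [NormedAddCommGroup E] [NormedSpace ℝ E] [NormedAddCommGroup F]
  [NormedSpace ℝ F]

lemma hasDerivAt_fderiv_comp_apply {u : E → F} (hu : ContDiff ℝ 2 u) {γ δ : ℝ → E} {v a : E}
    {t : ℝ} (hγ : HasDerivAt γ v t) (hδ : HasDerivAt δ a t) :
    HasDerivAt (fun s => fderiv ℝ u (γ s) (δ s))
      (fderiv ℝ (fderiv ℝ u) (γ t) v (δ t) + fderiv ℝ u (γ t) a) t := by
  have hdu : Differentiable ℝ (fderiv ℝ u) :=
    (hu.fderiv_right (m := 1) (by norm_num)).differentiable one_ne_zero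
  exact ((hdu _).hasFDerivAt.comp_hasDerivAt t hγ).clm_apply hδ

lemma hasDerivAt_add_smul (z w : E) (t : ℝ) : HasDerivAt (fun t : ℝ => z + t • w) w t := by
  simpa using ((hasDerivAt_id t).smul_const w).const_add z

lemma fderiv_fderiv_apply_eq_of_hasDerivAt {u : E → F} (hu : ContDiff ℝ 2 u) {z w : E} {a : F}
    (h : HasDerivAt (fun t : ℝ => fderiv ℝ u (z + t • w) w) a 0) :
    fderiv ℝ (fderiv ℝ u) z w w = a := by
  simpa using
    (hasDerivAt_fderiv_comp_apply hu (hasDerivAt_add_smul z w 0) (hasDerivAt_const 0 w)).unique h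

lemma laplacian_eq_fderiv_fderiv (u : ℂ → F) (z : ℂ) :
    Δ u z = fderiv ℝ (fderiv ℝ u) z 1 1 +
      fderiv ℝ (fderiv ℝ u) z Complex.I Complex.I := by
  rw [InnerProductSpace.laplacian_eq_iteratedFDeriv_complexPlane]
  simp [iteratedFDeriv_two_apply]

lemma continuous_laplacian {u : ℂ → F} (hu : ContDiff ℝ 2 u) : Continuous (Δ u) := by
  have : Continuous (fderiv ℝ (fderiv ℝ u)) :=
    (hu.fderiv_right (m := 1) (by norm_num)).continuous_fderiv one_ne_zero
  rw [funext (laplacian_eq_fderiv_fderiv u)]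
  fun_prop

/- The trace of a symmetric bilinear form can be computed in the rotated basis `w`, `I * w`. -/
lemma fderiv_fderiv_apply_add_rotate {u : ℂ → F} (hu : ContDiff ℝ 2 u) (z w : ℂ) :
    fderiv ℝ (fderiv ℝ u) z w w + fderiv ℝ (fderiv ℝ u) z (Complex.I * w) (Complex.I * w) =
      ‖w‖ ^ 2 • Δ u z := by
  have hsymm : fderiv ℝ (fderiv ℝ u) z Complex.I 1 = fderiv ℝ (fderiv ℝ u) z 1 Complex.I :=
    hu.contDiffAt.isSymmSndFDerivAt (by simp) _ _
  have hw : w = w.re • (1 : ℂ) + w.im • Complex.I := by simp [Complex.re_add_im]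
  have hIw : Complex.I * w = -w.im • (1 : ℂ) + w.re • Complex.I := by
    apply Complex.ext <;> simp
  rw [laplacian_eq_fderiv_fderiv, Complex.sq_norm, Complex.normSq_apply, hIw]
  nth_rw 1 2 [hw]
  simp only [map_add, map_smul, add_apply, smul_apply, hsymm]
  module

lemma laplacian_comp_of_differentiable {v : ℂ → F} (hv : ContDiff ℝ 2 v) {g : ℂ → ℂ}
    (hg : Differentiable ℂ g) (z : ℂ) : Δ (v ∘ g) z = ‖deriv g z‖ ^ 2 • Δ v (g z) := by
  have hvg : ContDiff ℝ 2 (v ∘ g) := hv.comp (hg.contDiff.restrict_scalars ℝ)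
  have hline (h : ℂ → ℂ) (hh : Differentiable ℂ h) (w : ℂ) (t : ℝ) :
      HasDerivAt (fun t : ℝ => h (z + t • w)) (deriv h (z + t • w) * w) t := by
    simpa [Function.comp_def, mul_comm] using
      (hh _).hasDerivAt.scomp_of_eq t (hasDerivAt_add_smul z w t) rfl
  have hD (w : ℂ) : fderiv ℝ (fderiv ℝ (v ∘ g)) z w w =
      fderiv ℝ (fderiv ℝ v) (g z) (deriv g z * w) (deriv g z * w) +
        fderiv ℝ v (g z) (deriv (deriv g) z * w * w) := by
    apply fderiv_fderiv_apply_eq_of_hasDerivAt hvg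
    have hfst (t : ℝ) : fderiv ℝ (v ∘ g) (z + t • w) w =
        fderiv ℝ v (g (z + t • w)) (deriv g (z + t • w) * w) := by
      rw [fderiv_comp _ (hv.differentiable two_ne_zero _) ((hg _).restrictScalars ℝ),
        ((hg _).hasDerivAt.hasFDerivAt.restrictScalars ℝ).fderiv]
      simp [mul_comm]
    simp only [hfst]
    simpa using hasDerivAt_fderiv_comp_apply hv (hline g hg w 0)
      ((hline _ hg.deriv w 0).mul_const w)
  have hcancel : deriv (deriv g) z * Complex.I * Complex.I = -(deriv (deriv g) z * 1 * 1) := by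
    rw [mul_assoc, Complex.I_mul_I]; ring
  rw [laplacian_eq_fderiv_fderiv, hD, hD, hcancel, map_neg, ← fderiv_fderiv_apply_add_rotate hv,
    mul_one, mul_comm _ Complex.I]
  abel

lemma laplacian_log_add_norm_sq {c : ℝ} (hc : 0 < c) (z : ℂ) :
    Δ (fun w : ℂ => Real.log (c + ‖w‖ ^ 2)) z = 4 * c / (c + ‖z‖ ^ 2) ^ 2 := by
  have hpos (w : ℂ) : 0 < c + ‖w‖ ^ 2 := by positivity
  have hu : ContDiff ℝ 2 fun w : ℂ => Real.log (c + ‖w‖ ^ 2) :=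
    (contDiff_const.add (contDiff_norm_sq ℝ)).log fun w => (hpos w).ne'
  have hfst (z w : ℂ) : fderiv ℝ (fun w : ℂ => Real.log (c + ‖w‖ ^ 2)) z w =
      2 * inner ℝ z w / (c + ‖z‖ ^ 2) := by
    have := (((hasStrictFDerivAt_norm_sq z).hasFDerivAt.const_add c).log (hpos z).ne').fderiv
    simp only [this, smul_apply, innerSL_apply_apply, smul_eq_mul, nsmul_eq_mul, Nat.cast_ofNat,
      div_eq_inv_mul]
  have hsnd (w : ℂ) : fderiv ℝ (fderiv ℝ fun w : ℂ => Real.log (c + ‖w‖ ^ 2)) z w w =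
      (2 * ‖w‖ ^ 2 * (c + ‖z‖ ^ 2) - (2 * inner ℝ z w) ^ 2) / (c + ‖z‖ ^ 2) ^ 2 := by
    apply fderiv_fderiv_apply_eq_of_hasDerivAt hu
    simp only [hfst]
    have hline := hasDerivAt_add_smul z w 0
    have hnum := (hline.inner ℝ (hasDerivAt_const 0 w)).const_mul 2
    have hden := hline.norm_sq.const_add c
    refine (hnum.fun_div hden (hpos _).ne').congr_deriv ?_
    simp only [zero_smul, add_zero, inner_zero_right, zero_add, real_inner_self_eq_norm_sq]
    ring
  have hinner : inner ℝ z 1 ^ 2 + inner ℝ z Complex.I ^ 2 = ‖z‖ ^ 2 := by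
    rw [Complex.sq_norm, Complex.normSq_apply]
    simp [Complex.inner, pow_two]
  rw [laplacian_eq_fderiv_fderiv, hsnd, hsnd, ← add_div, norm_one, Complex.norm_I]
  congr 1
  linear_combination -4 * hinner

end Laplacian

section CircleAverage

open Laplacian Real

variable {F : Type*} [NormedAddCommGroup F] [NormedSpace ℝ F]

lemma hasDerivAt_intervalIntegral_of_continuous {f f' : ℝ → ℝ → F} (hf : ∀ r, Continuous (f r))
    (hf' : Continuous (Function.uncurry f')) (h : ∀ r θ, HasDerivAt (f · θ) (f' r θ) r)
    (a b r : ℝ) : HasDerivAt (fun s => ∫ θ in a..b, f s θ) (∫ θ in a..b, f' r θ) r := by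
  obtain ⟨C, hC⟩ := ((isCompact_closedBall r 1).prod isCompact_uIcc).exists_bound_of_continuousOn
    (f := Function.uncurry f') (s := Metric.closedBall r 1 ×ˢ Set.uIcc a b) hf'.continuousOn
  refine (intervalIntegral.hasDerivAt_integral_of_dominated_loc_of_deriv_le (bound := fun _ => C)
    (Metric.closedBall_mem_nhds r one_pos) (.of_forall fun s => (hf s).aestronglyMeasurable)
    ((hf r).intervalIntegrable a b) (hf'.uncurry_left r).aestronglyMeasurable
    (.of_forall fun θ hθ s hs => hC (s, θ) ⟨hs, Set.uIoc_subset_uIcc hθ⟩)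
    intervalIntegrable_const (.of_forall fun θ _ s _ => h s θ)).2

lemma hasDerivAt_circleMap_radius (c : ℂ) (r θ : ℝ) :
    HasDerivAt (fun s => circleMap c s θ) (circleMap 0 1 θ) r := by
  simpa [circleMap] using
    ((Complex.ofRealCLM.hasDerivAt (x := r)).mul_const (Complex.exp (θ * Complex.I))).const_add c

lemma circleMap_zero_eq_smul (r θ : ℝ) : circleMap 0 r θ = r • circleMap 0 1 θ := by
  simp [circleMap]

/-- `r` times the outward normal derivative of `u`, integrated over the angle: the flux of the
gradient of `u` through the circle of centre `c` and radius `r`. -/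
noncomputable def circleFlux (u : ℂ → F) (c : ℂ) (r : ℝ) : F :=
  ∫ θ in 0..2 * π, fderiv ℝ u (circleMap c r θ) (circleMap 0 r θ)

lemma circleFlux_zero (u : ℂ → F) (c : ℂ) : circleFlux u c 0 = 0 := by
  simp [circleFlux, circleMap]

lemma hasDerivAt_circleAverage {u : ℂ → F} (hu : ContDiff ℝ 1 u) (c : ℂ) {r : ℝ} (hr : r ≠ 0) :
    HasDerivAt (circleAverage u c) ((2 * π * r)⁻¹ • circleFlux u c r) r := by
  have : Continuous (fderiv ℝ u) := hu.continuous_fderiv one_ne_zero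
  have hint := hasDerivAt_intervalIntegral_of_continuous
    (f := fun r θ => u (circleMap c r θ))
    (f' := fun r θ => fderiv ℝ u (circleMap c r θ) (circleMap 0 1 θ))
    (fun r => hu.continuous.comp (continuous_circleMap c r))
    (by unfold circleMap; fun_prop)
    (fun r θ => ((hu.differentiable one_ne_zero) _).hasFDerivAt.comp_hasDerivAt r
      (hasDerivAt_circleMap_radius c r θ)) 0 (2 * π) r
  refine (hint.const_smul (2 * π)⁻¹).congr_deriv ?_
  simp only [circleFlux, circleMap_zero_eq_smul r, map_smul, intervalIntegral.integral_smul,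
    smul_smul]
  congr 1
  field_simp

lemma intervalIntegral_deriv_fderiv_tangent [CompleteSpace F] {u : ℂ → F} (hu : ContDiff ℝ 2 u)
    (c : ℂ) (r : ℝ) :
    ∫ θ in 0..2 * π, (fderiv ℝ (fderiv ℝ u) (circleMap c r θ) (Complex.I * circleMap 0 r θ)
      (Complex.I * circleMap 0 1 θ) - fderiv ℝ u (circleMap c r θ) (circleMap 0 1 θ)) = 0 := by
  have hdu : Continuous (fderiv ℝ u) := hu.continuous_fderiv two_ne_zero
  have : Continuous (fderiv ℝ (fderiv ℝ u)) :=
    (hu.fderiv_right (m := 1) (by norm_num)).continuous_fderiv one_ne_zero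
  have hderiv (θ : ℝ) :
      HasDerivAt (fun θ => fderiv ℝ u (circleMap c r θ) (Complex.I * circleMap 0 1 θ))
        (fderiv ℝ (fderiv ℝ u) (circleMap c r θ) (Complex.I * circleMap 0 r θ)
          (Complex.I * circleMap 0 1 θ) - fderiv ℝ u (circleMap c r θ) (circleMap 0 1 θ)) θ := by
    refine (hasDerivAt_fderiv_comp_apply hu (hasDerivAt_circleMap c r θ)
      ((hasDerivAt_circleMap 0 1 θ).const_mul Complex.I)).congr_deriv ?_
    rw [mul_comm (circleMap 0 1 θ), ← mul_assoc Complex.I, Complex.I_mul_I, neg_one_mul, map_neg,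
      mul_comm _ Complex.I, sub_eq_add_neg]
  rw [intervalIntegral.integral_eq_sub_of_hasDerivAt (fun θ _ => hderiv θ)]
  · simp [circleMap]
  · exact Continuous.intervalIntegrable (by unfold circleMap; fun_prop) _ _

/- In polar coordinates `r Δu = ∂ᵣ (r ∂ᵣ u) + ∂_θ (r⁻¹ ∂_θ u)`, and the last term has mean zero on
the circle. -/
lemma hasDerivAt_circleFlux [CompleteSpace F] {u : ℂ → F} (hu : ContDiff ℝ 2 u) (c : ℂ) (r : ℝ) :
    HasDerivAt (circleFlux u c) ((2 * π * r) • circleAverage (Δ u) c r) r := by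
  have hdu : Continuous (fderiv ℝ u) := hu.continuous_fderiv two_ne_zero
  have : Continuous (fderiv ℝ (fderiv ℝ u)) :=
    (hu.fderiv_right (m := 1) (by norm_num)).continuous_fderiv one_ne_zero
  have hΔu := continuous_laplacian hu
  have hint := hasDerivAt_intervalIntegral_of_continuous
    (f := fun r θ => fderiv ℝ u (circleMap c r θ) (circleMap 0 r θ))
    (fun r => by fun_prop) (by unfold circleMap Function.uncurry; fun_prop)
    (fun r θ => hasDerivAt_fderiv_comp_apply hu (hasDerivAt_circleMap_radius c r θ)
      (hasDerivAt_circleMap_radius 0 r θ)) 0 (2 * π) r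
  refine hint.congr_deriv ?_
  have hpolar (θ : ℝ) : fderiv ℝ (fderiv ℝ u) (circleMap c r θ) (circleMap 0 1 θ)
      (circleMap 0 r θ) + fderiv ℝ u (circleMap c r θ) (circleMap 0 1 θ) =
      r • Δ u (circleMap c r θ) -
        (fderiv ℝ (fderiv ℝ u) (circleMap c r θ) (Complex.I * circleMap 0 r θ)
          (Complex.I * circleMap 0 1 θ) - fderiv ℝ u (circleMap c r θ) (circleMap 0 1 θ)) := by
    have htrace := fderiv_fderiv_apply_add_rotate hu (circleMap c r θ) (circleMap 0 1 θ)
    rw [norm_circleMap_zero, abs_one, one_pow, one_smul] at htrace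
    rw [circleMap_zero_eq_smul r, ← htrace, mul_smul_comm]
    simp only [map_smul, smul_apply]
    module
  simp only [hpolar]
  rw [intervalIntegral.integral_sub, intervalIntegral_deriv_fderiv_tangent hu, sub_zero,
    intervalIntegral.integral_smul, circleAverage, smul_smul]
  · congr 1
    field_simp
  all_goals exact Continuous.intervalIntegrable (by fun_prop) _ _

lemma setIntegral_ball_eq_setIntegral_circleMap (v : ℂ → F) (c : ℂ) (R : ℝ) :
    ∫ z in Metric.ball c R, v z =
      ∫ p in Set.Ioo 0 R ×ˢ Set.Ioo (-π) π, p.1 • v (circleMap c p.1 p.2) := by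
  let Γ : ℝ × ℝ → ℂ := fun p => circleMap c p.1 p.2
  have hΓ : Measurable Γ := by
    unfold Γ circleMap
    fun_prop
  have hpolar (p : ℝ × ℝ) : c + Complex.polarCoord.symm p = Γ p := by
    simp [Γ, circleMap, Complex.exp_mul_I]
  have hpreimage : polarCoord.target ∩ Γ ⁻¹' Metric.ball c R =
      Set.Ioo 0 R ×ˢ Set.Ioo (-π) π := by
    ext ⟨r, θ⟩
    simp only [polarCoord_target, Γ, Set.mem_inter_iff, Set.mem_prod, Set.mem_Ioi, Set.mem_preimage,
      mem_ball_iff_norm, circleMap_sub_center, norm_circleMap_zero, Set.mem_Ioo]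
    exact ⟨fun ⟨⟨hr, hθ⟩, hrR⟩ => ⟨⟨hr, (le_abs_self r).trans_lt hrR⟩, hθ⟩,
      fun ⟨⟨hr, hrR⟩, hθ⟩ => ⟨⟨hr, hθ⟩, by rwa [abs_of_pos hr]⟩⟩
  rw [← integral_indicator Metric.isOpen_ball.measurableSet, ← integral_add_left_eq_self _ c,
    ← Complex.integral_comp_polarCoord_symm, ← hpreimage,
    ← setIntegral_indicator (hΓ Metric.isOpen_ball.measurableSet)]
  classical simp only [hpolar, Set.indicator_apply, Set.mem_preimage, smul_ite, smul_zero, Γ]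

lemma setIntegral_ball_eq_integral_circleAverage {v : ℂ → F} (hv : Continuous v) (c : ℂ) {R : ℝ}
    (hR : 0 ≤ R) :
    ∫ z in Metric.ball c R, v z = ∫ r in 0..R, (2 * π * r) • circleAverage v c r := by
  have hcont : Continuous fun p : ℝ × ℝ => p.1 • v (circleMap c p.1 p.2) := by
    unfold circleMap
    fun_prop
  have hperiod (r : ℝ) : Function.Periodic (fun θ => v (circleMap c r θ)) (2 * π) := fun θ => by
    simp only [periodic_circleMap c r θ]
  rw [setIntegral_ball_eq_setIntegral_circleMap, Measure.volume_eq_prod, setIntegral_prod,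
    ← integral_Ioc_eq_integral_Ioo, ← intervalIntegral.integral_of_le hR]
  · refine intervalIntegral.integral_congr fun r _ => ?_
    have hangle := (hperiod r).intervalIntegral_add_eq (-π) 0
    rw [zero_add, show -π + 2 * π = π by ring] at hangle
    simp only
    rw [← integral_Ioc_eq_integral_Ioo, ← intervalIntegral.integral_of_le (by linarith [pi_pos]),
      intervalIntegral.integral_smul, hangle, circleAverage, smul_smul]
    congr 1
    field_simp
  · exact (hcont.continuousOn.integrableOn_compact (isCompact_Icc.prod isCompact_Icc)).mono_set
      (Set.prod_mono Set.Ioo_subset_Icc_self Set.Ioo_subset_Icc_self)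

lemma circleFlux_eq_setIntegral_laplacian [CompleteSpace F] {u : ℂ → F} (hu : ContDiff ℝ 2 u)
    (c : ℂ) {R : ℝ} (hR : 0 ≤ R) : circleFlux u c R = ∫ z in Metric.ball c R, Δ u z := by
  have hΔu := continuous_laplacian hu
  rw [setIntegral_ball_eq_integral_circleAverage hΔu c hR,
    intervalIntegral.integral_eq_sub_of_hasDerivAt fun r _ => hasDerivAt_circleFlux hu c r,
    circleFlux_zero, sub_zero]
  exact Continuous.intervalIntegrable (by fun_prop) _ _

end CircleAverage

section Subharmonic

open Asymptotics Bornology Filter Laplacian Real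

variable {u : ℂ → ℝ}

lemma monotoneOn_circleFlux_of_laplacian_nonneg (hu : ContDiff ℝ 2 u) (hΔ : ∀ z, 0 ≤ Δ u z)
    (c : ℂ) : MonotoneOn (circleFlux u c) (Set.Ici 0) := by
  refine monotoneOn_of_hasDerivWithinAt_nonneg (convex_Ici 0)
    (fun r _ => (hasDerivAt_circleFlux hu c r).continuousAt.continuousWithinAt)
    (fun r _ => (hasDerivAt_circleFlux hu c r).hasDerivWithinAt) fun r hr => ?_
  rw [interior_Ici] at hr
  have hr' : 0 < r := hr
  exact mul_nonneg (by positivity) (circleAverage_nonneg_of_nonneg fun z _ => hΔ z)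

lemma circleFlux_nonneg_of_laplacian_nonneg (hu : ContDiff ℝ 2 u) (hΔ : ∀ z, 0 ≤ Δ u z)
    (c : ℂ) {r : ℝ} (hr : 0 ≤ r) : 0 ≤ circleFlux u c r :=
  (circleFlux_zero u c).symm.trans_le
    (monotoneOn_circleFlux_of_laplacian_nonneg hu hΔ c Set.self_mem_Ici hr hr)

lemma monotoneOn_circleAverage_of_laplacian_nonneg (hu : ContDiff ℝ 2 u) (hΔ : ∀ z, 0 ≤ Δ u z)
    (c : ℂ) : MonotoneOn (circleAverage u c) (Set.Ici 0) := by
  have := hu.continuous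
  refine monotoneOn_of_hasDerivWithinAt_nonneg (convex_Ici 0)
    (f' := fun r => (2 * π * r)⁻¹ • circleFlux u c r) (by fun_prop) (fun r hr => ?_) fun r hr => ?_
  all_goals
    rw [interior_Ici] at hr
    have hr' : 0 < r := hr
  · exact (hasDerivAt_circleAverage (hu.of_le one_le_two) c hr'.ne').hasDerivWithinAt
  · exact mul_nonneg (by positivity) (circleFlux_nonneg_of_laplacian_nonneg hu hΔ c hr'.le)

lemma le_circleAverage_of_laplacian_nonneg (hu : ContDiff ℝ 2 u) (hΔ : ∀ z, 0 ≤ Δ u z)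
    (c : ℂ) {r : ℝ} (hr : 0 ≤ r) : u c ≤ circleAverage u c r :=
  circleAverage_zero.symm.trans_le
    (monotoneOn_circleAverage_of_laplacian_nonneg hu hΔ c Set.self_mem_Ici hr hr)

lemma mul_le_setIntegral_ball (hu : ContDiff ℝ 2 u) (hΔ : ∀ z, 0 ≤ Δ u z)
    (c : ℂ) {r : ℝ} (hr : 0 ≤ r) :
    π * r ^ 2 * u c ≤ ∫ z in Metric.ball c r, u z := by
  have := hu.continuous
  calc π * r ^ 2 * u c = ∫ s in 0..r, 2 * π * u c * s := by
        rw [intervalIntegral.integral_const_mul, integral_id]; ring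
    _ ≤ ∫ s in 0..r, (2 * π * s) • circleAverage u c s := by
        refine intervalIntegral.integral_mono_on hr
          (Continuous.intervalIntegrable (by fun_prop) _ _)
          (Continuous.intervalIntegrable (by fun_prop) _ _) fun s hs => ?_
        rw [mul_right_comm (2 * π) _ s, smul_eq_mul]
        exact mul_le_mul_of_nonneg_left (le_circleAverage_of_laplacian_nonneg hu hΔ c hs.1)
          (mul_nonneg two_pi_pos.le hs.1)
    _ = ∫ z in Metric.ball c r, u z := (setIntegral_ball_eq_integral_circleAverage this c hr).symm

lemma setIntegral_ball_le_mul_circleAverage (hu : ContDiff ℝ 2 u) (hΔ : ∀ z, 0 ≤ Δ u z)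
    (c : ℂ) {r : ℝ} (hr : 0 ≤ r) :
    ∫ z in Metric.ball c r, u z ≤ π * r ^ 2 * circleAverage u c r := by
  have := hu.continuous
  calc ∫ z in Metric.ball c r, u z = ∫ s in 0..r, (2 * π * s) • circleAverage u c s :=
        setIntegral_ball_eq_integral_circleAverage this c hr
    _ ≤ ∫ s in 0..r, 2 * π * circleAverage u c r * s := by
        refine intervalIntegral.integral_mono_on hr
          (Continuous.intervalIntegrable (by fun_prop) _ _)
          (Continuous.intervalIntegrable (by fun_prop) _ _) fun s hs => ?_
        rw [mul_right_comm (2 * π) _ s, smul_eq_mul]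
        exact mul_le_mul_of_nonneg_left
          (monotoneOn_circleAverage_of_laplacian_nonneg hu hΔ c hs.1 hr hs.2)
          (mul_nonneg two_pi_pos.le hs.1)
    _ = π * r ^ 2 * circleAverage u c r := by
        rw [intervalIntegral.integral_const_mul, integral_id]; ring

/- Compare the disc of radius `dist z c` around `z` with the disc of twice that radius around `c`:
the ratio of the areas is `4`. -/
lemma le_four_mul_circleAverage (hu : ContDiff ℝ 2 u) (hΔ : ∀ z, 0 ≤ Δ u z)
    (hu₀ : ∀ z, 0 ≤ u z) {c z : ℂ} (hz : z ≠ c) :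
    u z ≤ 4 * circleAverage u c (2 * dist z c) := by
  have hz' : 0 < dist z c := dist_pos.2 hz
  have hint : IntegrableOn u (Metric.ball c (2 * dist z c)) :=
    (hu.continuous.continuousOn.integrableOn_compact (isCompact_closedBall c _)).mono_set
      Metric.ball_subset_closedBall
  have hsub : Metric.ball z (dist z c) ⊆ Metric.ball c (2 * dist z c) :=
    Metric.ball_subset_ball' (two_mul _).ge
  have h : π * dist z c ^ 2 * u z ≤ π * dist z c ^ 2 * (4 * circleAverage u c (2 * dist z c)) :=
    calc π * dist z c ^ 2 * u z ≤ ∫ w in Metric.ball z (dist z c), u w :=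
          mul_le_setIntegral_ball hu hΔ z hz'.le
      _ ≤ ∫ w in Metric.ball c (2 * dist z c), u w :=
          setIntegral_mono_set hint (.of_forall hu₀) hsub.eventuallyLE
      _ ≤ π * (2 * dist z c) ^ 2 * circleAverage u c (2 * dist z c) :=
          setIntegral_ball_le_mul_circleAverage hu hΔ c (by positivity)
      _ = π * dist z c ^ 2 * (4 * circleAverage u c (2 * dist z c)) := by ring
  exact le_of_mul_le_mul_left h (by positivity)

lemma hasDerivAt_circleAverage_exp (hu : ContDiff ℝ 1 u) (c : ℂ) (s : ℝ) :
    HasDerivAt (fun s => circleAverage u c (exp s)) ((2 * π)⁻¹ * circleFlux u c (exp s)) s := by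
  refine ((hasDerivAt_circleAverage hu c (exp_ne_zero s)).comp s
    (Real.hasDerivAt_exp s)).congr_deriv ?_
  rw [smul_eq_mul]
  field_simp

lemma circleFlux_mul_log_div_le (hu : ContDiff ℝ 2 u) (hΔ : ∀ z, 0 ≤ Δ u z)
    (c : ℂ) {a b : ℝ} (ha : 0 < a) (hab : a ≤ b) :
    circleFlux u c a * log (b / a) ≤ 2 * π * (circleAverage u c b - circleAverage u c a) := by
  have hb := ha.trans_le hab
  have hderiv := hasDerivAt_circleAverage_exp (hu.of_le one_le_two) c
  have hmean := (convex_Icc (log a) (log b)).mul_sub_le_image_sub_of_le_deriv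
    (f := fun s => circleAverage u c (exp s)) (C := (2 * π)⁻¹ * circleFlux u c a)
    (fun s _ => (hderiv s).continuousAt.continuousWithinAt)
    (fun s _ => (hderiv s).differentiableAt.differentiableWithinAt) (fun s hs => ?_)
    (log a) (Set.left_mem_Icc.2 (log_le_log ha hab)) (log b)
    (Set.right_mem_Icc.2 (log_le_log ha hab)) (log_le_log ha hab)
  · simp only [exp_log ha, exp_log hb] at hmean
    rw [log_div hb.ne' ha.ne', ← inv_mul_le_iff₀ two_pi_pos, ← mul_assoc]
    exact hmean
  · rw [(hderiv s).deriv]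
    have has : a ≤ exp s := (log_le_iff_le_exp ha).1 (interior_subset hs).1
    gcongr
    exact monotoneOn_circleFlux_of_laplacian_nonneg hu hΔ c ha.le (exp_pos s).le has

lemma le_circleFlux_mul_log_div (hu : ContDiff ℝ 2 u) (hΔ : ∀ z, 0 ≤ Δ u z)
    (c : ℂ) {a b : ℝ} (ha : 0 < a) (hab : a ≤ b) :
    2 * π * (circleAverage u c b - circleAverage u c a) ≤ circleFlux u c b * log (b / a) := by
  have hb := ha.trans_le hab
  have hderiv := hasDerivAt_circleAverage_exp (hu.of_le one_le_two) c
  have hmean := (convex_Icc (log a) (log b)).image_sub_le_mul_sub_of_deriv_le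
    (f := fun s => circleAverage u c (exp s)) (C := (2 * π)⁻¹ * circleFlux u c b)
    (fun s _ => (hderiv s).continuousAt.continuousWithinAt)
    (fun s _ => (hderiv s).differentiableAt.differentiableWithinAt) (fun s hs => ?_)
    (log a) (Set.left_mem_Icc.2 (log_le_log ha hab)) (log b)
    (Set.right_mem_Icc.2 (log_le_log ha hab)) (log_le_log ha hab)
  · simp only [exp_log ha, exp_log hb] at hmean
    rw [log_div hb.ne' ha.ne', ← le_inv_mul_iff₀ two_pi_pos, ← mul_assoc]
    exact hmean
  · rw [(hderiv s).deriv]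
    have hsb : exp s ≤ b := (le_log_iff_exp_le hb).1 (interior_subset hs).2
    gcongr
    exact monotoneOn_circleFlux_of_laplacian_nonneg hu hΔ c (exp_pos s).le hb.le hsb

theorem isBigO_log_of_integrable_laplacian (hu : ContDiff ℝ 2 u) (hΔ : ∀ z, 0 ≤ Δ u z)
    (hu₀ : ∀ z, 0 ≤ u z) (hint : Integrable (Δ u)) :
    u =O[cobounded ℂ] fun z => log ‖z‖ := by
  set T := ∫ z, Δ u z
  set m := circleAverage u 0 1
  have hm : 0 ≤ m := circleAverage_nonneg_of_nonneg fun z _ => hu₀ z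
  have hflux {r : ℝ} (hr : 0 ≤ r) : circleFlux u 0 r ≤ T := by
    rw [circleFlux_eq_setIntegral_laplacian hu 0 hr]
    exact setIntegral_le_integral hint (.of_forall hΔ)
  have hT : 0 ≤ T := (circleFlux_zero u 0).symm.trans_le (hflux le_rfl)
  refine .of_bound (4 * (m + T)) ?_
  filter_upwards [eventually_cobounded_le_norm (exp 1)] with z hz
  have hlog : 1 ≤ log ‖z‖ := (le_log_iff_exp_le ((exp_pos 1).trans_le hz)).2 hz
  have hz2 : 2 ≤ ‖z‖ := by linarith [add_one_le_exp 1]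
  have hz0 : z ≠ 0 := norm_pos_iff.1 (by linarith)
  have hlog2 : log (2 * ‖z‖) ≤ 2 * log ‖z‖ := by
    rw [log_mul two_ne_zero (by linarith), two_mul]
    gcongr
  have haverage : circleAverage u 0 (2 * ‖z‖) - m ≤ T * log ‖z‖ := by
    refine le_of_mul_le_mul_left ?_ two_pi_pos
    calc 2 * π * (circleAverage u 0 (2 * ‖z‖) - m)
        ≤ circleFlux u 0 (2 * ‖z‖) * log (2 * ‖z‖ / 1) :=
          le_circleFlux_mul_log_div hu hΔ 0 one_pos (by linarith)
      _ ≤ T * (2 * log ‖z‖) := by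
          rw [div_one]
          exact mul_le_mul (hflux (by positivity)) hlog2 (log_nonneg (by linarith)) hT
      _ ≤ 2 * π * (T * log ‖z‖) := by
          nlinarith [pi_gt_three, mul_nonneg hT (zero_le_one.trans hlog)]
  rw [norm_of_nonneg (hu₀ z), norm_of_nonneg (by linarith)]
  calc u z ≤ 4 * circleAverage u 0 (2 * ‖z‖) :=
        dist_zero_right z ▸ le_four_mul_circleAverage hu hΔ hu₀ hz0
    _ ≤ 4 * (m + T * log ‖z‖) := by linarith
    _ ≤ 4 * (m + T) * log ‖z‖ := by nlinarith

theorem integrable_laplacian_of_isBigO_log (hu : ContDiff ℝ 2 u) (hΔ : ∀ z, 0 ≤ Δ u z)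
    (hO : u =O[cobounded ℂ] fun z => log ‖z‖) : Integrable (Δ u) := by
  obtain ⟨C, hC⟩ := hO.bound
  obtain ⟨R₀, -, hR₀⟩ := hasBasis_cobounded_norm.eventually_iff.1 hC
  have haverage {r : ℝ} (hr : 1 ≤ r) (hrR₀ : R₀ ≤ r) : |circleAverage u 0 r| ≤ C * log r := by
    have := hu.continuous
    refine abs_circleAverage_le_circleAverage_abs.trans
      (circleAverage_mono_on_of_le_circle (this.abs.continuousOn.circleIntegrable' ) fun z hz => ?_)
    have hzr : ‖z‖ = r := by simpa [abs_of_nonneg (zero_le_one.trans hr)] using hz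
    simpa [hzr, abs_of_nonneg (log_nonneg hr)] using hR₀ (hzr.symm ▸ hrR₀ : R₀ ≤ ‖z‖)
  have hflux : ∀ᶠ r in atTop, ∫ z in Metric.ball 0 r, Δ u z ≤ 2 * π * (3 * C) := by
    filter_upwards [eventually_ge_atTop R₀, eventually_ge_atTop 2] with R hR hR2
    have hlog : 0 < log R := log_pos (by linarith)
    have hRR : R ≤ R ^ 2 := by nlinarith
    have hsq : log (R ^ 2) = 2 * log R := by simp
    rw [← circleFlux_eq_setIntegral_laplacian hu 0 (by linarith)]
    refine le_of_mul_le_mul_right ?_ hlog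
    calc circleFlux u 0 R * log R = circleFlux u 0 R * log (R ^ 2 / R) := by
          rw [pow_two, mul_self_div_self]
      _ ≤ 2 * π * (circleAverage u 0 (R ^ 2) - circleAverage u 0 R) :=
          circleFlux_mul_log_div_le hu hΔ 0 (by linarith) hRR
      _ ≤ 2 * π * (C * log (R ^ 2) - -(C * log R)) := by
          gcongr
          · exact (abs_le.1 (haverage (by linarith) (hR.trans hRR))).2
          · exact (abs_le.1 (haverage (by linarith) hR)).1
      _ = 2 * π * (3 * C) * log R := by rw [hsq]; ring
  refine (aecover_ball tendsto_id).integrable_of_integral_bounded_of_nonneg_ae (2 * π * (3 * C))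
    (fun r => ((continuous_laplacian hu).continuousOn.integrableOn_compact
      (isCompact_closedBall 0 r)).mono_set Metric.ball_subset_closedBall) (.of_forall hΔ) hflux

theorem integrable_laplacian_iff_isBigO_log (hu : ContDiff ℝ 2 u) (hΔ : ∀ z, 0 ≤ Δ u z)
    (hu₀ : ∀ z, 0 ≤ u z) : Integrable (Δ u) ↔ u =O[cobounded ℂ] fun z => log ‖z‖ :=
  ⟨isBigO_log_of_integrable_laplacian hu hΔ hu₀, integrable_laplacian_of_isBigO_log hu hΔ⟩

end Subharmonic

section EntirePolynomial

open Asymptotics Bornology Complex Filter Polynomial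

variable {g : ℂ → ℂ} {n : ℕ}

lemma iteratedDeriv_eq_zero_of_isBigO_norm_pow (hg : Differentiable ℂ g)
    (hO : g =O[cobounded ℂ] fun z => ‖z‖ ^ n) {k : ℕ} (hk : n < k) : iteratedDeriv k g 0 = 0 := by
  obtain ⟨C, hC₀, hC⟩ := hO.exists_nonneg
  obtain ⟨R₀, -, hR₀⟩ := hasBasis_cobounded_norm.eventually_iff.1 hC.bound
  have hcauchy : ∀ᶠ R : ℝ in atTop, ‖iteratedDeriv k g 0‖ ≤ k.factorial * C / R := by
    filter_upwards [eventually_ge_atTop R₀, eventually_ge_atTop 1] with R hRR₀ hR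
    have hR' : 0 < R := by linarith
    calc ‖iteratedDeriv k g 0‖ ≤ k.factorial * (C * R ^ n) / R ^ k := by
          refine norm_iteratedDeriv_le_of_forall_mem_sphere_norm_le k hR' hg.diffContOnCl
            fun z hz => ?_
          have hzR : ‖z‖ = R := by simpa using hz
          simpa [hzR, abs_of_pos hR'] using hR₀ (hzR.symm ▸ hRR₀ : R₀ ≤ ‖z‖)
      _ ≤ k.factorial * (C * R ^ n) / R ^ (n + 1) := by gcongr; exact hk
      _ = k.factorial * C / R := by field_simp; ring
  exact norm_le_zero_iff.1 (ge_of_tendsto (tendsto_id.const_div_atTop _) hcauchy)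

lemma exists_eq_eval_of_iteratedDeriv_eq_zero (hg : Differentiable ℂ g)
    (hzero : ∀ k, n < k → iteratedDeriv k g 0 = 0) : ∃ p : ℂ[X], ∀ z, g z = p.eval z := by
  refine ⟨∑ k ∈ Finset.range (n + 1), monomial k ((k.factorial : ℂ)⁻¹ * iteratedDeriv k g 0),
    fun z => ?_⟩
  rw [← taylorSeries_eq_of_entire' 0 z hg, tsum_eq_sum (s := Finset.range (n + 1)), eval_finsetSum]
  · simp [eval_monomial]
  · intro k hk
    simp [hzero k (by simpa using hk)]

lemma isBigO_norm_pow_natDegree_eval (p : ℂ[X]) :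
    (fun z => p.eval z) =O[cobounded ℂ] fun z => ‖z‖ ^ p.natDegree := by
  simpa using (isBigO_cobounded_of_degree_le (P := p) (Q := X ^ p.natDegree)
    (by simp)).norm_right

theorem exists_eq_eval_iff_isBigO_norm_pow (hg : Differentiable ℂ g) :
    (∃ p : ℂ[X], ∀ z, g z = p.eval z) ↔ ∃ n : ℕ, g =O[cobounded ℂ] fun z => ‖z‖ ^ n := by
  refine ⟨fun ⟨p, hp⟩ => ⟨p.natDegree, funext hp ▸ isBigO_norm_pow_natDegree_eval p⟩, ?_⟩
  rintro ⟨n, hn⟩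
  exact exists_eq_eval_of_iteratedDeriv_eq_zero hg fun k =>
    iteratedDeriv_eq_zero_of_isBigO_norm_pow hg hn

lemma exists_deriv_eq_eval_iff (hg : Differentiable ℂ g) :
    (∃ p : ℂ[X], ∀ z, deriv g z = p.eval z) ↔ ∃ p : ℂ[X], ∀ z, g z = p.eval z := by
  constructor
  · rintro ⟨p, hp⟩
    refine exists_eq_eval_of_iteratedDeriv_eq_zero (n := p.natDegree + 1) hg fun k hk => ?_
    obtain ⟨k, rfl⟩ := Nat.exists_eq_add_one_of_ne_zero (Nat.ne_zero_of_lt hk)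
    have hderiv : deriv g = fun z => p.eval z := funext hp
    rw [iteratedDeriv_succ', hderiv]
    exact iteratedDeriv_eq_zero_of_isBigO_norm_pow p.differentiable
      (isBigO_norm_pow_natDegree_eval p) (by lia)
  · rintro ⟨p, hp⟩
    have hg' : g = fun z => p.eval z := funext hp
    exact ⟨p.derivative, fun z => by rw [hg', Polynomial.deriv]⟩

lemma isBigO_norm_pow_of_re_isBigO (hg : Differentiable ℂ g)
    (hO : (fun z => (g z).re) =O[⊤] fun z => (1 + ‖z‖) ^ n) :
    g =O[cobounded ℂ] fun z => ‖z‖ ^ n := by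
  obtain ⟨C, hC₀, hC⟩ := hO.exists_pos
  rw [isBigOWith_top] at hC
  refine .of_bound (2 * (C * 3 ^ n) + 3 * ‖g 0‖)
    (hasBasis_cobounded_norm.eventually_iff.2 ⟨1, trivial, fun z hz => ?_⟩)
  have hz₁ : 1 ≤ ‖z‖ := hz
  have : 0 < ‖z‖ := by linarith
  have hmaps : Set.MapsTo g (Metric.ball 0 (2 * ‖z‖)) {w | w.re ≤ C * (3 * ‖z‖) ^ n} := by
    intro w hw
    have hw' : 1 + ‖w‖ ≤ 3 * ‖z‖ := by linarith [mem_ball_zero_iff.1 hw]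
    calc (g w).re ≤ C * ‖(1 + ‖w‖) ^ n‖ := (le_abs_self _).trans (hC w)
      _ = C * (1 + ‖w‖) ^ n := by rw [Real.norm_of_nonneg (by positivity)]
      _ ≤ C * (3 * ‖z‖) ^ n := by gcongr
  have hcaratheodory := borelCaratheodory (by positivity) hg.differentiableOn hmaps
    (by positivity) (mem_ball_zero_iff.2 (by linarith : ‖z‖ < 2 * ‖z‖))
  calc ‖g z‖ ≤ 2 * (C * (3 * ‖z‖) ^ n) * ‖z‖ / (2 * ‖z‖ - ‖z‖) +
        ‖g 0‖ * (2 * ‖z‖ + ‖z‖) / (2 * ‖z‖ - ‖z‖) := hcaratheodory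
    _ = 2 * (C * 3 ^ n) * ‖z‖ ^ n + 3 * ‖g 0‖ * 1 := by
        rw [mul_pow]
        field_simp
        ring
    _ ≤ 2 * (C * 3 ^ n) * ‖z‖ ^ n + 3 * ‖g 0‖ * ‖z‖ ^ n := by
        gcongr
        exact one_le_pow₀ hz₁
    _ ≤ (2 * (C * 3 ^ n) + 3 * ‖g 0‖) * ‖‖z‖ ^ n‖ := by
        rw [Real.norm_of_nonneg (by positivity), add_mul]

end EntirePolynomial

section Growth

open Asymptotics Filter Real

variable {α E : Type*} [SeminormedAddCommGroup E] {l : Filter α} {f : α → ℝ}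

lemma exists_isBigO_pow_eval_mvPolynomial {σ : Type*} {x : α → σ → ℝ} (hf : ∀ a, 1 ≤ f a)
    (hx : ∀ i, (fun a => x a i) =O[l] f) (P : MvPolynomial σ ℝ) :
    ∃ n : ℕ, (fun a => MvPolynomial.eval (x a) P) =O[l] fun a => f a ^ n := by
  have hmono {m n : ℕ} (hmn : m ≤ n) : (fun a => f a ^ m) =O[l] fun a => f a ^ n :=
    .of_norm_le fun a => by
      simpa [abs_of_nonneg (zero_le_one.trans (hf a))] using pow_le_pow_right₀ (hf a) hmn
  induction P using MvPolynomial.induction_on with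
  | C c => exact ⟨0, by simpa using isBigO_const_const c (one_ne_zero (α := ℝ)) l⟩
  | add P Q hP hQ =>
    obtain ⟨m, hm⟩ := hP
    obtain ⟨n, hn⟩ := hQ
    exact ⟨max m n, by
      simpa using (hm.trans (hmono (le_max_left m n))).add (hn.trans (hmono (le_max_right m n)))⟩
  | mul_X P i hP =>
    obtain ⟨n, hn⟩ := hP
    exact ⟨n + 1, by simpa [pow_succ] using hn.mul (hx i)⟩

lemma exists_isBigO_pow_of_isBigO_log {c : ℝ} (hc : 1 ≤ c) (hf : Tendsto f l atTop) {g : α → E}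
    (hO : (fun a => log (c + ‖g a‖ ^ 2)) =O[l] fun a => log (f a)) :
    ∃ n : ℕ, g =O[l] fun a => f a ^ n := by
  obtain ⟨C, hC⟩ := hO.bound
  obtain ⟨n, hn⟩ := exists_nat_ge C
  refine ⟨n, .of_bound 1 ?_⟩
  filter_upwards [hC, hf.eventually_ge_atTop 1] with a ha hfa
  rw [norm_of_nonneg (log_nonneg hfa)] at ha
  have hlog : log (c + ‖g a‖ ^ 2) ≤ log (f a ^ n) :=
    calc log (c + ‖g a‖ ^ 2) ≤ C * log (f a) := (le_norm_self _).trans ha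
      _ ≤ n * log (f a) := by gcongr; exact log_nonneg hfa
      _ = log (f a ^ n) := (log_pow _ _).symm
  calc ‖g a‖ ≤ c + ‖g a‖ ^ 2 := by nlinarith [sq_nonneg (‖g a‖ - 1)]
    _ ≤ f a ^ n := (log_le_log_iff (by positivity) (by positivity)).1 hlog
    _ ≤ 1 * ‖f a ^ n‖ := by rw [one_mul]; exact le_norm_self _

lemma isBigO_log_of_isBigO_pow {c : ℝ} (hc : 1 ≤ c) (hf : Tendsto f l atTop) {g : α → E} {n : ℕ}
    (hO : g =O[l] fun a => f a ^ n) :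
    (fun a => log (c + ‖g a‖ ^ 2)) =O[l] fun a => log (f a) := by
  obtain ⟨C, hC⟩ := hO.bound
  refine .of_bound (2 * n + 1 : ℕ) ?_
  filter_upwards [hC, hf.eventually_ge_atTop 1, hf.eventually_ge_atTop (c + C ^ 2)]
    with a ha hfa hfc
  have hpow : c + ‖g a‖ ^ 2 ≤ f a ^ (2 * n + 1) :=
    calc c + ‖g a‖ ^ 2 ≤ c * 1 + (C * f a ^ n) ^ 2 := by
          rw [mul_one]
          gcongr
          rwa [norm_of_nonneg (by positivity)] at ha
      _ ≤ c * f a ^ (2 * n) + (C * f a ^ n) ^ 2 := by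
          gcongr
          exact one_le_pow₀ hfa
      _ = (c + C ^ 2) * f a ^ (2 * n) := by ring
      _ ≤ f a * f a ^ (2 * n) := by gcongr
      _ = f a ^ (2 * n + 1) := by ring
  rw [norm_of_nonneg (log_nonneg (by nlinarith [sq_nonneg ‖g a‖])), norm_of_nonneg (log_nonneg hfa),
    ← log_pow]
  exact log_le_log (by positivity) hpow

theorem isBigO_log_add_norm_sq_iff {c : ℝ} (hc : 1 ≤ c) (hf : Tendsto f l atTop) {g : α → E} :
    (fun a => log (c + ‖g a‖ ^ 2)) =O[l] (fun a => log (f a)) ↔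
      ∃ n : ℕ, g =O[l] fun a => f a ^ n :=
  ⟨exists_isBigO_pow_of_isBigO_log hc hf, fun ⟨_, hn⟩ => isBigO_log_of_isBigO_pow hc hf hn⟩

end Growth

section RealImaginaryParts

open Polynomial

lemma exists_mvPolynomial_re_im (q : ℂ[X]) : ∃ P Q : MvPolynomial (Fin 2) ℝ, ∀ z : ℂ,
    (q.eval z).re = MvPolynomial.eval ![z.re, z.im] P ∧
      (q.eval z).im = MvPolynomial.eval ![z.re, z.im] Q := by
  induction q using Polynomial.induction_on with
  | C a => exact ⟨MvPolynomial.C a.re, MvPolynomial.C a.im, fun z => by simp⟩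
  | add p q hp hq =>
    obtain ⟨P₁, Q₁, h₁⟩ := hp
    obtain ⟨P₂, Q₂, h₂⟩ := hq
    exact ⟨P₁ + P₂, Q₁ + Q₂, fun z => by simp [(h₁ z).1, (h₁ z).2, (h₂ z).1, (h₂ z).2]⟩
  | monomial n a h =>
    obtain ⟨P, Q, h⟩ := h
    refine ⟨P * MvPolynomial.X 0 - Q * MvPolynomial.X 1,
      P * MvPolynomial.X 1 + Q * MvPolynomial.X 0, fun z => ?_⟩
    rw [pow_succ, ← mul_assoc, eval_mul, eval_X, Complex.mul_re, Complex.mul_im, (h z).1, (h z).2]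
    simp

theorem exists_re_eq_eval_mvPolynomial_iff {g : ℂ → ℂ} (hg : Differentiable ℂ g) :
    (∃ P : MvPolynomial (Fin 2) ℝ, ∀ z, (g z).re = MvPolynomial.eval ![z.re, z.im] P) ↔
      ∃ p : ℂ[X], ∀ z, g z = p.eval z := by
  constructor
  · rintro ⟨P, hP⟩
    have hx (i : Fin 2) : (fun z : ℂ => ![z.re, z.im] i) =O[⊤] fun z => 1 + ‖z‖ := by
      refine .of_norm_le fun z => ?_
      fin_cases i
      · exact (Complex.abs_re_le_norm z).trans (by simp)
      · exact (Complex.abs_im_le_norm z).trans (by simp)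
    obtain ⟨n, hn⟩ := exists_isBigO_pow_eval_mvPolynomial (fun z => by simp) hx P
    exact (exists_eq_eval_iff_isBigO_norm_pow hg).2
      ⟨n, isBigO_norm_pow_of_re_isBigO hg (by simpa only [hP] using hn)⟩
  · rintro ⟨p, hp⟩
    obtain ⟨P, _, hP⟩ := exists_mvPolynomial_re_im p
    exact ⟨P, fun z => by rw [hp, (hP z).1]⟩

end RealImaginaryParts

namespace IsotropicSpace

section TotalCurvature

open Bornology Laplacian Polynomial

variable {ρ : ℂ → ℝ} {g : ℂ → ℂ} {c : ℝ}

theorem hasFiniteTotalCurvature_iff_integrable_laplacian_log (hρ : ContDiff ℝ 2 ρ)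
    (hpos : ∀ z, 0 < ρ z) :
    HasFiniteTotalCurvature ρ ↔ Integrable (Δ fun z => Real.log (ρ z)) := by
  have hΔ : Continuous (Δ fun z => Real.log (ρ z)) :=
    continuous_laplacian (hρ.log fun z => (hpos z).ne')
  have hK : Continuous (gaussCurvature ρ) :=
    hΔ.neg.div (continuous_const.mul hρ.continuous) fun z => (mul_pos two_pos (hpos z)).ne'
  have hKρ (z : ℂ) : ENNReal.ofReal (ρ z) * ‖gaussCurvature ρ z‖ₑ =
      ‖(2⁻¹ : ℝ) * Δ (fun w => Real.log (ρ w)) z‖ₑ := by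
    rw [← Real.enorm_of_nonneg (hpos z).le, ← enorm_mul, ← enorm_neg]
    congr 1
    rw [gaussCurvature]
    field [(hpos z).ne']
  have hmass : ∫⁻ z, ‖gaussCurvature ρ z‖ₑ ∂areaMeasure ρ =
      ∫⁻ z, ‖(2⁻¹ : ℝ) * Δ (fun w => Real.log (ρ w)) z‖ₑ :=
    (lintegral_withDensity_eq_lintegral_mul _ hρ.continuous.measurable.ennreal_ofReal
      hK.enorm.measurable).trans (lintegral_congr hKρ)
  rw [HasFiniteTotalCurvature, hmass,
    ← integrable_const_mul_iff (c := (2⁻¹ : ℝ)) (by norm_num), Integrable,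
    and_iff_right (hΔ.aestronglyMeasurable.const_mul _), HasFiniteIntegral]

lemma contDiff_add_norm_sq (hg : Differentiable ℂ g) {n : ℕ∞} :
    ContDiff ℝ n fun z => c + ‖g z‖ ^ 2 :=
  contDiff_const.add ((hg.contDiff.restrict_scalars ℝ).norm_sq ℝ)

lemma laplacian_log_add_norm_sq_comp_nonneg (hg : Differentiable ℂ g) (hc : 0 < c) (z : ℂ) :
    0 ≤ Δ (fun w => Real.log (c + ‖g w‖ ^ 2)) z := by
  have hlog : ContDiff ℝ 2 fun w : ℂ => Real.log (c + ‖w‖ ^ 2) :=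
    (contDiff_add_norm_sq differentiable_id).log fun w => by positivity
  have hcomp := laplacian_comp_of_differentiable hlog hg z
  rw [laplacian_log_add_norm_sq hc, smul_eq_mul] at hcomp
  exact hcomp.ge.trans' (by positivity)

theorem hasFiniteTotalCurvature_add_norm_sq_iff (hg : Differentiable ℂ g) (hc : 1 ≤ c) :
    HasFiniteTotalCurvature (fun z => c + ‖g z‖ ^ 2) ↔ ∃ p : ℂ[X], ∀ z, g z = p.eval z := by
  have hpos (z : ℂ) : 0 < c + ‖g z‖ ^ 2 := by positivity
  have hsmooth : ContDiff ℝ 2 fun z => c + ‖g z‖ ^ 2 := contDiff_add_norm_sq hg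
  rw [hasFiniteTotalCurvature_iff_integrable_laplacian_log hsmooth hpos,
    integrable_laplacian_iff_isBigO_log (hsmooth.log fun z => (hpos z).ne')
      (laplacian_log_add_norm_sq_comp_nonneg hg (zero_lt_one.trans_le hc))
      fun z => Real.log_nonneg (by nlinarith [sq_nonneg ‖g z‖]),
    isBigO_log_add_norm_sq_iff hc tendsto_norm_cobounded_atTop,
    exists_eq_eval_iff_isBigO_norm_pow hg]

end TotalCurvature

section Graph

open Polynomial

variable {φ : ℂ → ℝ} {G : ℂ → ℂ}

lemma fderiv_re_apply (hG : Differentiable ℂ G) (z v : ℂ) :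
    fderiv ℝ (fun w => (G w).re) z v = (deriv G z * v).re := by
  have hre := Complex.reCLM.hasFDerivAt.comp z ((hG z).hasDerivAt.hasFDerivAt.restrictScalars ℝ)
  calc fderiv ℝ (fun w => (G w).re) z v = (v * deriv G z).re := DFunLike.congr_fun hre.fderiv v
    _ = (deriv G z * v).re := by rw [mul_comm]

lemma deriv_eq_two_mul_wirtinger (hG : Differentiable ℂ G) (hre : ∀ z, φ z = (G z).re) (z : ℂ) :
    deriv G z = 2 * wirtinger φ z := by
  rw [wirtinger, funext hre, fderiv_re_apply hG, fderiv_re_apply hG, mul_div_cancel₀ _ two_ne_zero]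
  apply Complex.ext <;> simp

lemma wirtinger_re (z : ℂ) : 2 * wirtinger Complex.re z = 1 := by
  rw [← deriv_eq_two_mul_wirtinger (G := fun w => w) differentiable_id (fun _ => rfl), deriv_id'']

lemma wirtinger_im (z : ℂ) : 2 * wirtinger Complex.im z = -Complex.I := by
  rw [← deriv_eq_two_mul_wirtinger (G := fun w => -Complex.I * w) (by fun_prop) (by simp)]
  simp

theorem liftDensity_eq_of_isHolomorphicLift_graph {F : ℂ → Fin 3 → ℂ}
    (hF : IsHolomorphicLift F (graph φ)) :
    liftDensity F = fun z => 2 + ‖2 * wirtinger φ z‖ ^ 2 := by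
  have hd := differentiable_pi.1 hF.isNullImmersion.holomorphic
  funext z
  have hF₀ : deriv (fun w => F w 0) z = 2 * wirtinger φ z :=
    deriv_eq_two_mul_wirtinger (hd 0) (fun w => hF.re_eq w 0) z
  have hF₁ : deriv (fun w => F w 1) z = 1 :=
    (deriv_eq_two_mul_wirtinger (hd 1) (fun w => hF.re_eq w 1) z).trans (wirtinger_re z)
  have hF₂ : deriv (fun w => F w 2) z = -Complex.I :=
    (deriv_eq_two_mul_wirtinger (hd 2) (fun w => hF.re_eq w 2) z).trans (wirtinger_im z)
  rw [liftDensity, Fin.sum_univ_three, hF₀, hF₁, hF₂, norm_one, norm_neg, Complex.norm_I]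
  ring

theorem isHolomorphicLift_graph (hG : Differentiable ℂ G) (hre : ∀ z, φ z = (G z).re) :
    IsHolomorphicLift (fun z => ![G z, z, -Complex.I * z]) (graph φ) := by
  have hd (i : Fin 3) : Differentiable ℂ fun z => ![G z, z, -Complex.I * z] i := by
    fin_cases i
    · exact hG
    · exact differentiable_id
    · exact differentiable_id.const_mul (-Complex.I)
  refine ⟨⟨differentiable_pi.2 hd, fun z hz => ?_, fun z => by simp, fun ⟨c, hc⟩ => ?_⟩,
    fun z i => ?_⟩
  · have hF₁ := congrFun hz 1
    rw [deriv_pi fun i => hd i z] at hF₁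
    simp at hF₁
  · exact one_ne_zero ((hc 1).trans (hc 0).symm)
  · fin_cases i <;> simp [graph, hre]

theorem isFiniteTypeZMCFace_graph_iff (hG : Differentiable ℂ G) (hre : ∀ z, φ z = (G z).re) :
    IsFiniteTypeZMCFace (graph φ) ↔
      HasFiniteTotalCurvature fun z => 2 + ‖2 * wirtinger φ z‖ ^ 2 := by
  constructor
  · rintro ⟨F, hF, -, hcurvature⟩
    rwa [liftDensity_eq_of_isHolomorphicLift_graph hF] at hcurvature
  · intro hcurvature
    have hlift := isHolomorphicLift_graph hG hre
    refine ⟨_, hlift, ?_, ?_⟩ <;> rw [liftDensity_eq_of_isHolomorphicLift_graph hlift]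
    · simp only [← deriv_eq_two_mul_wirtinger hG hre]
      exact ⟨contDiff_add_norm_sq hG.deriv, fun z => by positivity⟩
    · exact hcurvature

lemma exists_wirtinger_eq_eval_iff (hG : Differentiable ℂ G) (hre : ∀ z, φ z = (G z).re) :
    (∃ p : ℂ[X], ∀ z, wirtinger φ z = p.eval z) ↔ ∃ p : ℂ[X], ∀ z, deriv G z = p.eval z := by
  simp only [deriv_eq_two_mul_wirtinger hG hre]
  constructor
  · rintro ⟨p, hp⟩
    exact ⟨C 2 * p, fun z => by rw [hp, eval_mul, eval_C]⟩
  · rintro ⟨p, hp⟩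
    exact ⟨C 2⁻¹ * p, fun z => by
      rw [eval_mul, eval_C, ← hp, inv_mul_cancel_left₀ two_ne_zero]⟩

end Graph

end IsotropicSpace

theorem mainTheorem5 (φ : ℂ → ℝ) (hφ : InnerProductSpace.HarmonicOnNhd φ Set.univ) :
    IsotropicSpace.IsZMCFace (IsotropicSpace.graph φ) ∧
    (IsotropicSpace.IsFiniteTypeZMCFace (IsotropicSpace.graph φ) ↔
      IsotropicSpace.IsHarmonicPolynomial φ) ∧
    (∀ F : ℂ → Fin 3 → ℂ, IsotropicSpace.IsHolomorphicLift F (IsotropicSpace.graph φ) →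
      IsotropicSpace.liftDensity F = fun z => 2 + ‖2 * IsotropicSpace.wirtinger φ z‖ ^ 2) ∧
    (IsotropicSpace.IsFiniteTypeZMCFace (IsotropicSpace.graph φ) ↔
      IsotropicSpace.HasFiniteTotalCurvature
        (fun z => 2 + ‖2 * IsotropicSpace.wirtinger φ z‖ ^ 2)) ∧
    (IsotropicSpace.HasFiniteTotalCurvature
        (fun z => 2 + ‖2 * IsotropicSpace.wirtinger φ z‖ ^ 2) ↔
      ∃ p : Polynomial ℂ, ∀ z, IsotropicSpace.wirtinger φ z = p.eval z) := by
  obtain ⟨G, hGan, hGre⟩ := hφ.exists_analyticOnNhd_univ_re_eq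
  have hG : Differentiable ℂ G := fun z => (hGan z (Set.mem_univ z)).differentiableAt
  have hre : ∀ z, φ z = (G z).re := fun z => (congrFun hGre z).symm
  have hmetric := IsotropicSpace.isFiniteTypeZMCFace_graph_iff hG hre
  have hwirtinger := IsotropicSpace.exists_wirtinger_eq_eval_iff hG hre
  have hcurvature : IsotropicSpace.HasFiniteTotalCurvature
        (fun z => 2 + ‖2 * IsotropicSpace.wirtinger φ z‖ ^ 2) ↔
      ∃ p : Polynomial ℂ, ∀ z, deriv G z = p.eval z := by
    simp only [← IsotropicSpace.deriv_eq_two_mul_wirtinger hG hre]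
    exact IsotropicSpace.hasFiniteTotalCurvature_add_norm_sq_iff hG.deriv one_le_two
  refine ⟨⟨_, IsotropicSpace.isHolomorphicLift_graph hG hre⟩, ?_,
    fun F => IsotropicSpace.liftDensity_eq_of_isHolomorphicLift_graph, hmetric,
    hcurvature.trans hwirtinger.symm⟩
  rw [hmetric, hcurvature, exists_deriv_eq_eval_iff hG, ← exists_re_eq_eval_mvPolynomial_iff hG,
    IsotropicSpace.IsHarmonicPolynomial, and_iff_right hφ]
  simp only [hre]
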